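/- Let $G$ be a torsion-free finitely generated nilpotent group, and let $u=(u_1,\dots,u_n)$ be a canonical basis of $G$: there is a central series $G=G_0>G_1>\dots>G_n=1$ whose factors $G_{i-1}/G_i$ are infinite cyclic and such that $G_{i-1}=\langle G_i,u_i\rangle$ for $i=1,\dots,n$. Then every $x\in G$ is uniquely of the form $x=u_1^{\xi_1}\cdots u_n^{\xi_n}$ with integers $\xi_1,\dots,\xi_n$, called the canonical parameters of $x$. For each $i=1,\dots,n$ there exist polynomials $f_i\in\mathbb{Q}[X_1,\dots,X_n,Y_1,\dots,Y_n]$ and $g_i\in\mathbb{Q}[T,X_1,\dots,X_n]$, depending only on $G$ and $u$, such that for all $x,y\in G$ with canonical parameters $\xi,\eta$ and all $\lambda\in\mathbb{Z}$, the $i$-th canonical parameter of $xy$ is $f_i(\xi_1,\dots,\xi_n,\eta_1,\dots,\eta_n)$, and the $i$-th canonical parameter of $x^\lambda$ is $g_i(\lambda,\xi_1,\dots,\xi_n)$. -/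

import Mathlib

/-- The ordered product `u^ξ = u₁^ξ₁ u₂^ξ₂ ⋯ uₙ^ξₙ`. -/
def canonicalProd {G : Type*} [Group G] {n : ℕ} (u : Fin n → G) (ξ : Fin n → ℤ) : G :=
  (List.ofFn fun i => u i ^ ξ i).prod

/-- `u = (u₁, …, uₙ)` is a canonical basis of `G`: there is a central series
`G = H 0 > H 1 > ⋯ > H n = 1` with infinite cyclic factors, such that `H (i - 1)` is generated by
`H i` and `uᵢ` (in the code the index `i` starts at `0`).
Thus the factor group is generated by the image of `uᵢ`, and `infinite` says that
this image has infinite order. -/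
def IsCanonicalBasis {G : Type*} [Group G] {n : ℕ} (u : Fin n → G) : Prop :=
  ∃ H : ℕ → Subgroup G,
    Subgroup.IsDescendingCentralSeries H ∧ H n = ⊥ ∧
    (∀ i : Fin n, H i = H (i + 1) ⊔ Subgroup.zpowers (u i)) ∧
    (∀ (i : Fin n) (k : ℤ), u i ^ k ∈ H (i + 1) → k = 0)

theorem canonicalProd_succ {G : Type*} [Group G] {n : ℕ} (u : Fin (n + 1) → G)
    (ξ : Fin (n + 1) → ℤ) :
    canonicalProd u ξ = u 0 ^ ξ 0 * canonicalProd (fun i => u i.succ) (fun i => ξ i.succ) := by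
  simp [canonicalProd, List.ofFn_succ]

theorem canonicalProd_mem_and_existsUnique {G : Type*} [Group G] {n : ℕ} :
    ∀ (u : Fin n → G) (H : ℕ → Subgroup G), (∀ i ≤ n, (H i).Normal) → H n = ⊥ →
    (∀ i : Fin n, H i = H (i + 1) ⊔ Subgroup.zpowers (u i)) →
    (∀ (i : Fin n) (k : ℤ), u i ^ k ∈ H (i + 1) → k = 0) →
    (∀ ξ, canonicalProd u ξ ∈ H 0) ∧ ∀ x ∈ H 0, ∃! ξ, canonicalProd u ξ = x := by
  induction n with
  | zero =>
    intro u H _ hbot _ _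
    refine ⟨fun ξ => by simp [canonicalProd, one_mem], fun x hx => ⟨Fin.elim0, ?_, ?_⟩⟩
    · rw [hbot, Subgroup.mem_bot] at hx
      simp [canonicalProd, hx]
    · intro ξ _
      exact Subsingleton.elim _ _
  | succ n ih =>
    intro u H hN hbot hgen hinf
    obtain ⟨hmem, huniq⟩ := ih (fun i => u i.succ) (fun i => H (i + 1))
      (fun i hi => hN _ (by omega)) hbot (fun i => by simpa using hgen i.succ)
      (fun i k hk => hinf i.succ k (by simpa using hk))
    have h0 : H 0 = H 1 ⊔ Subgroup.zpowers (u 0) := by simpa using hgen 0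
    have hi0 : ∀ k : ℤ, u 0 ^ k ∈ H 1 → k = 0 := fun k hk => hinf 0 k (by simpa using hk)
    simp only [zero_add] at hmem huniq
    have hN1 : (H 1).Normal := hN 1 (by omega)
    refine ⟨fun ξ => ?_, fun x hx => ?_⟩
    · rw [canonicalProd_succ, h0]
      exact mul_mem (Subgroup.mem_sup_right ⟨ξ 0, rfl⟩) (Subgroup.mem_sup_left (hmem _))
    · rw [h0, sup_comm, Subgroup.mem_sup_of_normal_right] at hx
      obtain ⟨_, ⟨k, rfl⟩, h, hh, rfl⟩ := hx
      obtain ⟨ξ, hξ, hu⟩ := huniq h hh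
      refine ⟨Fin.cons k ξ, ?_, ?_⟩
      · simp [canonicalProd_succ, hξ]
      · intro ξ' h'
        simp only [canonicalProd_succ] at h'
        have hk : ξ' 0 - k = 0 := by
          apply hi0
          have hm : u 0 ^ (ξ' 0 - k) =
              (u 0 ^ k * (h * (canonicalProd (fun i => u i.succ) fun i => ξ' i.succ)⁻¹)
                * (u 0 ^ k)⁻¹) := by
            rw [← mul_assoc, ← h', sub_eq_add_neg, zpow_add, zpow_neg]
            group
          rw [hm]
          exact hN1.conj_mem _ (mul_mem hh (inv_mem (hmem _))) _
        have hk' : ξ' 0 = k := by omega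
        rw [hk'] at h'
        have hs := hu _ (mul_left_cancel h')
        rw [← hs, ← hk']
        exact (Fin.cons_self_tail ξ').symm

/-- Every element of `G` is uniquely of the form `u^ξ`. -/
theorem IsCanonicalBasis.bijective {G : Type*} [Group G] {n : ℕ} {u : Fin n → G}
    (hu : IsCanonicalBasis u) : Function.Bijective (canonicalProd u) := by
  obtain ⟨H, ⟨htop, hc⟩, hbot, hgen, hinf⟩ := hu
  have hN : ∀ i ≤ n, (H i).Normal := by
    intro i hi
    rcases hi.eq_or_lt with rfl | hlt
    · rw [hbot]; infer_instance
    · have hle : H (i + 1) ≤ H i := by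
        have := hgen ⟨i, hlt⟩
        simp only at this
        rw [this]; exact le_sup_left
      refine ⟨fun x hx g => ?_⟩
      have h1 := mul_mem hx (hle (hc x⁻¹ i (inv_mem hx) g))
      simpa [commutatorElement_def, mul_assoc] using h1
  obtain ⟨-, h⟩ := canonicalProd_mem_and_existsUnique u H hN hbot hgen hinf
  exact Function.bijective_iff_existsUnique _ |>.2 fun x => h x (by simp [htop])

/-- The canonical parameters of `x` with respect to the canonical basis `u`:
the unique `ξ` with `x = u^ξ`. -/
noncomputable def IsCanonicalBasis.param {G : Type*} [Group G] {n : ℕ} {u : Fin n → G}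
    (hu : IsCanonicalBasis u) (x : G) : Fin n → ℤ :=
  (Equiv.ofBijective _ hu.bijective).symm x

theorem IsCanonicalBasis.canonicalProd_param {G : Type*} [Group G] {n : ℕ} {u : Fin n → G}
    (hu : IsCanonicalBasis u) (x : G) : canonicalProd u (hu.param x) = x :=
  (Equiv.ofBijective _ hu.bijective).apply_symm_apply x

/-! Everything rests on discrete integration: a rational polynomial has a polynomial indefinite sum,
so a map whose differences are polynomial is polynomial. `IsPolyMap.of_difference` lifts this to
`G`, one parameter at a time: by `mul_param_eq`, parameters add under multiplication up to a
correction in earlier parameters. Powers follow from `x ^ (k + 1) = x ^ k * x`. Multiplication is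
treated by induction on `n`. With `v`, `w` in the tail, `u 0 ^ a * v * (u 0 ^ b * w) = u 0 ^ (a + b)
* (v' * w)`, where `v'` is the conjugate of `v` by `u 0 ^ b`. Its dependence on `b` is polynomial
because the differences in `b` are conjugates of commutators, which lie deeper in the chain. -/

open scoped commutatorElement

/-! ### Integer-valued polynomial functions and discrete integration. -/

open MvPolynomial in
/-- Integer-valued functions on `ℤ^σ` that are given by a polynomial with rational coefficients. -/
def IsPolyFun {σ : Type*} (f : (σ → ℤ) → ℤ) : Prop :=
  ∃ p : MvPolynomial σ ℚ, ∀ x, (f x : ℚ) = eval (fun i => (x i : ℚ)) p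

namespace IsPolyFun

variable {σ τ : Type*} {f g : (σ → ℤ) → ℤ}

theorem const (c : ℤ) : IsPolyFun (fun _ : σ → ℤ => c) :=
  ⟨MvPolynomial.C (c : ℚ), fun x => by simp⟩

theorem proj (i : σ) : IsPolyFun (fun x : σ → ℤ => x i) :=
  ⟨MvPolynomial.X i, fun x => by simp⟩

theorem add (hf : IsPolyFun f) (hg : IsPolyFun g) : IsPolyFun (fun x => f x + g x) := by
  obtain ⟨p, hp⟩ := hf
  obtain ⟨q, hq⟩ := hg
  exact ⟨p + q, fun x => by simp [hp, hq]⟩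

theorem comp {f : (τ → ℤ) → ℤ} (hf : IsPolyFun f) {g : τ → (σ → ℤ) → ℤ}
    (hg : ∀ i, IsPolyFun (g i)) : IsPolyFun (fun x => f (fun i => g i x)) := by
  obtain ⟨p, hp⟩ := hf
  choose q hq using hg
  refine ⟨MvPolynomial.bind₁ q p, fun x => ?_⟩
  have hqx : (fun i => ((g i x : ℤ) : ℚ)) =
      fun i => MvPolynomial.eval (fun i => (x i : ℚ)) (q i) := funext fun i => hq i x
  rw [hp, hqx, MvPolynomial.eval, MvPolynomial.eval, MvPolynomial.eval₂Hom_bind₁]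

end IsPolyFun

/-- Every polynomial has an indefinite sum with respect to a given variable. -/
theorem MvPolynomial.exists_indefiniteSum {σ : Type*} [DecidableEq σ] (t : σ)
    (p : MvPolynomial σ ℚ) :
    ∃ q : MvPolynomial σ ℚ, ∀ x : σ → ℚ,
      eval (Function.update x t (x t + 1)) q = eval x q + eval x p := by
  induction p using MvPolynomial.induction_on' with
  | add p₁ p₂ h₁ h₂ =>
    obtain ⟨q₁, h₁⟩ := h₁
    obtain ⟨q₂, h₂⟩ := h₂
    refine ⟨q₁ + q₂, fun x => ?_⟩
    simp only [map_add, h₁, h₂]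
    ring
  | monomial d c =>
    -- Bernoulli polynomials sum powers: `B_{m+1}(y + 1) - B_{m+1}(y) = (m + 1) y ^ m`.
    have hb : ∀ y : ℚ, (Polynomial.bernoulli (d t + 1)).eval (y + 1) =
        (Polynomial.bernoulli (d t + 1)).eval y + (d t + 1) * y ^ d t := by
      intro y
      have := Polynomial.bernoulli_eval_one_add (d t + 1) y
      rw [add_comm y 1, this]
      simp
    refine ⟨C ((d t + 1 : ℚ)⁻¹) * Polynomial.aeval (X t) (Polynomial.bernoulli (d t + 1)) *
      monomial (d.erase t) c, fun x => ?_⟩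
    have hev : ∀ (y : σ → ℚ) (r : Polynomial ℚ),
        eval y (Polynomial.aeval (X t : MvPolynomial σ ℚ) r) = r.eval (y t) := by
      intro y r
      have := Polynomial.hom_eval₂ r (algebraMap ℚ (MvPolynomial σ ℚ)) (eval y) (X t)
      rw [Polynomial.aeval_def, this, Polynomial.eval, eval_X]
      congr 1
      exact Subsingleton.elim _ _
    have herase : ∀ y : ℚ, eval (Function.update x t y) (monomial (d.erase t) c) =
        eval x (monomial (d.erase t) c) := by
      intro y
      simp only [eval_monomial]
      congr 1
      refine Finsupp.prod_congr fun i hi => ?_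
      rw [Function.update_of_ne]
      rintro rfl
      simp at hi
    have hmon : eval x (monomial d c) = x t ^ d t * eval x (monomial (d.erase t) c) := by
      simp only [eval_monomial]
      rw [← Finsupp.mul_prod_erase' d t (fun i e => x i ^ e) (fun _ => pow_zero _)]
      ring
    have h0 : (d t + 1 : ℚ) ≠ 0 := by positivity
    simp only [map_mul, herase, hev, eval_C, hmon, Function.update_self, hb]
    field_simp

/-- A function with polynomial differences in the variable `t` that is polynomial for `t = 0` is
polynomial. -/
theorem IsPolyFun.of_difference {σ : Type*} [DecidableEq σ] (t : σ) {f g : (σ → ℤ) → ℤ}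
    (h0 : IsPolyFun (fun x => f (Function.update x t 0))) (hg : IsPolyFun g)
    (h : ∀ x, f (Function.update x t (x t + 1)) = f x + g x) : IsPolyFun f := by
  obtain ⟨p₀, hp₀⟩ := h0
  obtain ⟨p, hp⟩ := hg
  obtain ⟨q, hq⟩ := MvPolynomial.exists_indefiniteSum t p
  have hcast : ∀ (x : σ → ℤ) (k : ℤ), (fun i => ((Function.update x t k i : ℤ) : ℚ)) =
      Function.update (fun i => (x i : ℚ)) t (k : ℚ) := by
    intro x k
    funext i
    by_cases hi : i = t
    · subst hi; simp
    · simp [hi]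
  let ev (x : σ → ℤ) (r : MvPolynomial σ ℚ) : ℚ := MvPolynomial.eval (fun i => (x i : ℚ)) r
  -- `f - q` is invariant under the unit shift in `t`, hence equals its value at `t = 0`.
  have hstep : ∀ x : σ → ℤ, (f (Function.update x t (x t + 1)) : ℚ)
      - ev (Function.update x t (x t + 1)) q = f x - ev x q := by
    intro x
    have := hq (fun i => (x i : ℚ))
    simp only [ev, hcast, h]
    push_cast
    rw [this, hp]
    ring
  have hinv : ∀ (x : σ → ℤ) (k : ℤ), (f (Function.update x t k) : ℚ)
      - ev (Function.update x t k) q =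
      f (Function.update x t 0) - ev (Function.update x t 0) q := by
    intro x k
    have hs : ∀ k : ℤ, (f (Function.update x t (k + 1)) : ℚ)
        - ev (Function.update x t (k + 1)) q =
        f (Function.update x t k) - ev (Function.update x t k) q := by
      intro k
      simpa using hstep (Function.update x t k)
    induction k using Int.induction_on with
    | zero => rfl
    | succ k ih => rw [hs, ih]
    | pred k ih =>
      rw [← ih, ← hs]
      simp
  refine ⟨p₀ + q - MvPolynomial.bind₁
    (Function.update MvPolynomial.X t (0 : MvPolynomial σ ℚ)) q, fun x => ?_⟩
  have h1 := hinv x (x t)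
  rw [Function.update_eq_self] at h1
  have h2 : MvPolynomial.eval (fun i => (x i : ℚ)) (MvPolynomial.bind₁
      (Function.update MvPolynomial.X t (0 : MvPolynomial σ ℚ)) q) =
      ev (Function.update x t 0) q := by
    simp only [ev, hcast]
    rw [MvPolynomial.eval, MvPolynomial.eval₂Hom_bind₁]
    congr 2
    funext i
    by_cases hi : i = t
    · subst hi; simp
    · simp [hi]
  rw [map_sub, map_add, h2, ← hp₀]
  simp only [ev] at h1 ⊢
  linarith

/-! ### Central chains and their parameters. -/

/-- A descending chain of subgroups `H 0 ≥ H 1 ≥ ⋯ ≥ H n = 1` of `G`, with `⁅H i, G⁆ ≤ H (i + 1)`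
and with infinite cyclic factors generated by the `u i`. -/
structure IsCentralChain {G : Type*} [Group G] {n : ℕ} (u : Fin n → G) (H : ℕ → Subgroup G) :
    Prop where
  le : ∀ i, H (i + 1) ≤ H i
  -- Here `g` ranges over `G` and `H 0` may be proper, so a tail is again a chain, and may be
  -- conjugated by `u 0`.
  comm : ∀ i, ∀ x ∈ H i, ∀ g : G, ⁅x, g⁆ ∈ H (i + 1)
  bot : H n = ⊥
  gen : ∀ i : Fin n, H i = H (i + 1) ⊔ Subgroup.zpowers (u i)
  infinite : ∀ (i : Fin n) (k : ℤ), u i ^ k ∈ H (i + 1) → k = 0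

/-- The map `φ` is a product of powers of the `u i` with polynomial exponents. -/
def IsPolyMap {G : Type*} [Group G] {n : ℕ} (u : Fin n → G) {σ : Type*} (φ : (σ → ℤ) → G) :
    Prop :=
  ∃ ζ : (σ → ℤ) → Fin n → ℤ, (∀ i, IsPolyFun fun x => ζ x i) ∧ ∀ x, φ x = canonicalProd u (ζ x)

/-- Multiplication of ordered products of powers of the `u i` is polynomial. -/
def HasPolyMul {G : Type*} [Group G] {n : ℕ} (u : Fin n → G) : Prop :=
  IsPolyMap u fun x : Fin n ⊕ Fin n → ℤ =>
    canonicalProd u (fun i => x (Sum.inl i)) * canonicalProd u (fun i => x (Sum.inr i))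

section

variable {G : Type*} [Group G]

namespace IsCentralChain

variable {n : ℕ}

theorem normal {u : Fin n → G} {H : ℕ → Subgroup G} (h : IsCentralChain u H) (i : ℕ) :
    (H i).Normal := by
  refine ⟨fun x hx g => ?_⟩
  have h1 := mul_mem hx (h.le i (h.comm i x⁻¹ (inv_mem hx) g))
  simpa [commutatorElement_def, mul_assoc] using h1

theorem tail {u : Fin (n + 1) → G} {H : ℕ → Subgroup G} (h : IsCentralChain u H) :
    IsCentralChain (fun i => u i.succ) (fun i => H (i + 1)) where
  le i := h.le _
  comm i := h.comm _
  bot := h.bot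
  gen i := by simpa using h.gen i.succ
  infinite i k hk := h.infinite i.succ k (by simpa using hk)

theorem canonicalProd_mem {u : Fin n → G} {H : ℕ → Subgroup G} (h : IsCentralChain u H)
    (ξ : Fin n → ℤ) : canonicalProd u ξ ∈ H 0 :=
  (canonicalProd_mem_and_existsUnique u H (fun i _ => h.normal i) h.bot h.gen h.infinite).1 ξ

theorem exists_canonicalProd {u : Fin n → G} {H : ℕ → Subgroup G} (h : IsCentralChain u H)
    {x : G} (hx : x ∈ H 0) : ∃ ξ, canonicalProd u ξ = x :=
  ((canonicalProd_mem_and_existsUnique u H (fun i _ => h.normal i) h.bot h.gen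
    h.infinite).2 x hx).exists

theorem canonicalProd_injective {u : Fin n → G} {H : ℕ → Subgroup G} (h : IsCentralChain u H) :
    Function.Injective (canonicalProd u) := fun ξ ξ' hξ =>
  ((canonicalProd_mem_and_existsUnique u H (fun i _ => h.normal i) h.bot h.gen
    h.infinite).2 _ (h.canonicalProd_mem ξ)).unique rfl hξ.symm

theorem antitone {u : Fin n → G} {H : ℕ → Subgroup G} (h : IsCentralChain u H) : Antitone H :=
  antitone_nat_of_succ_le h.le

theorem generator_mem {u : Fin n → G} {H : ℕ → Subgroup G} (h : IsCentralChain u H) (i : Fin n) :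
    u i ∈ H i := by
  rw [h.gen i]
  exact Subgroup.mem_sup_right (Subgroup.mem_zpowers _)

/-- Factors after the `i`-th lie in `H (i + 1)` and vanish in the quotient. -/
theorem mk_canonicalProd_of_agree {u : Fin n → G} {H : ℕ → Subgroup G}
    (h : IsCentralChain u H) [∀ i, (H i).Normal] (i : Fin n) {ξ ξ' : Fin n → ℤ}
    (hξ : ∀ j < i, ξ' j = ξ j) :
    ((canonicalProd u ξ' : G) : G ⧸ H (i + 1)) =
      (canonicalProd u ξ : G) * (u i : G ⧸ H (i + 1)) ^ (ξ' i - ξ i) := by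
  induction n generalizing H with
  | zero => exact i.elim0
  | succ n ih =>
    rw [canonicalProd_succ, canonicalProd_succ]
    refine Fin.cases (fun _ => ?_) (fun i hξ => ?_) i hξ
    · have h1 : ∀ η, ((canonicalProd (fun i => u i.succ) η : G) :
          G ⧸ H (((0 : Fin (n + 1)) : ℕ) + 1)) = 1 := fun η =>
        (QuotientGroup.eq_one_iff _).2 (h.tail.canonicalProd_mem η)
      rw [QuotientGroup.mk_mul, QuotientGroup.mk_mul, h1, h1, mul_one, mul_one,
        QuotientGroup.mk_zpow, QuotientGroup.mk_zpow, ← zpow_add]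
      congr 1
      ring
    · have := ih h.tail i (ξ := fun i => ξ i.succ) (ξ' := fun i => ξ' i.succ)
        (fun j hj => hξ _ (Fin.succ_lt_succ_iff.2 hj))
      rw [hξ 0 (Fin.succ_pos i), QuotientGroup.mk_mul, QuotientGroup.mk_mul, mul_assoc]
      exact congrArg _ this

/-- Modulo `H 1` only the power of `u 0` survives, and it has infinite order. The leading factors
thus agree and cancel, leaving the tail. -/
theorem eq_of_mk_eq {u : Fin n → G} {H : ℕ → Subgroup G}
    (h : IsCentralChain u H) [∀ i, (H i).Normal] (i : Fin n) {ξ ξ' : Fin n → ℤ}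
    (hξ : ((canonicalProd u ξ : G) : G ⧸ H (i + 1)) = (canonicalProd u ξ' : G)) : ξ i = ξ' i := by
  induction n generalizing H with
  | zero => exact i.elim0
  | succ n ih =>
    rw [canonicalProd_succ, canonicalProd_succ] at hξ
    have h0 : ξ 0 = ξ' 0 := by
      have h1 : ∀ η, ((canonicalProd (fun i => u i.succ) η : G) : G ⧸ H 1) = 1 := fun η =>
        (QuotientGroup.eq_one_iff _).2 (h.tail.canonicalProd_mem η)
      have h2 := QuotientGroup.eq.2 (h.antitone (Nat.le_add_left 1 i) (QuotientGroup.eq.1 hξ))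
      rw [QuotientGroup.mk_mul, QuotientGroup.mk_mul, h1, h1, mul_one, mul_one,
        QuotientGroup.eq, ← zpow_neg, ← zpow_add] at h2
      have := h.infinite 0 _ h2
      omega
    revert hξ
    refine Fin.cases (fun _ => h0) (fun i hξ => ?_) i
    refine ih h.tail i (ξ := fun i => ξ i.succ) (ξ' := fun i => ξ' i.succ) ?_
    rw [h0, QuotientGroup.mk_mul, QuotientGroup.mk_mul] at hξ
    exact mul_left_cancel hξ

/-- The `i`-th parameter of a product is the sum of the `i`-th parameters up to a correction that
depends only on the preceding parameters. -/
theorem mul_param_eq {u : Fin n → G} {H : ℕ → Subgroup G} (h : IsCentralChain u H)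
    (i : Fin n) {ξ η ζ ζ' : Fin n → ℤ}
    (hζ : canonicalProd u ξ * canonicalProd u η = canonicalProd u ζ)
    (hζ' : canonicalProd u (fun j => if j < i then ξ j else 0) *
      canonicalProd u (fun j => if j < i then η j else 0) = canonicalProd u ζ') :
    ζ i = ζ' i + (ξ i + η i) := by
  have := h.normal
  have htr : ∀ θ : Fin n → ℤ, ((canonicalProd u θ : G) : G ⧸ H (i + 1)) =
      (canonicalProd u (fun j => if j < i then θ j else 0) : G) * (u i : G ⧸ H (i + 1)) ^ θ i := by
    intro θ
    have := h.mk_canonicalProd_of_agree i (ξ' := θ) (ξ := fun j => if j < i then θ j else 0)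
      (fun j hj => by simp [hj])
    simpa using this
  -- `u i` is central modulo `H (i + 1)`, so its powers can be collected on the right.
  have hcomm : ∀ g : G ⧸ H (i + 1), Commute (u i : G ⧸ H (i + 1)) g := by
    intro g
    obtain ⟨g, rfl⟩ := QuotientGroup.mk_surjective g
    have h1 := h.comm i _ (h.generator_mem i) g
    rw [← QuotientGroup.eq_one_iff] at h1
    exact commutatorElement_eq_one_iff_commute.1 h1
  have hup := h.mk_canonicalProd_of_agree i (ξ := ζ')
    (ξ' := Function.update ζ' i (ζ' i + (ξ i + η i)))
    (fun j hj => Function.update_of_ne hj.ne _ _)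
  have key := h.eq_of_mk_eq i (ξ := ζ) (ξ' := Function.update ζ' i (ζ' i + (ξ i + η i))) (by
    rw [hup, ← hζ, ← hζ', QuotientGroup.mk_mul, QuotientGroup.mk_mul, htr ξ, htr η,
      Function.update_self, add_sub_cancel_left, zpow_add, mul_assoc, mul_assoc]
    congr 1
    rw [← mul_assoc, ← mul_assoc, ((hcomm _).zpow_left (ξ i)).eq])
  simpa using key

end IsCentralChain

/-! ### Polynomial maps into the group. -/

namespace IsPolyMap

variable {n : ℕ} {σ τ : Type*} {u : Fin n → G}

theorem of_canonicalProd {ζ : (σ → ℤ) → Fin n → ℤ} (hζ : ∀ i, IsPolyFun fun x => ζ x i) :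
    IsPolyMap u fun x => canonicalProd u (ζ x) := ⟨ζ, hζ, fun _ => rfl⟩

theorem const (ξ : Fin n → ℤ) : IsPolyMap u fun _ : σ → ℤ => canonicalProd u ξ :=
  of_canonicalProd fun i => .const (ξ i)

theorem one : IsPolyMap u fun _ : σ → ℤ => (1 : G) :=
  ⟨fun _ _ => 0, fun _ => .const 0, fun _ => by simp [canonicalProd]⟩

theorem comp {φ : (τ → ℤ) → G} (hφ : IsPolyMap u φ) {g : τ → (σ → ℤ) → ℤ}
    (hg : ∀ i, IsPolyFun (g i)) : IsPolyMap u (fun x => φ (fun i => g i x)) := by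
  obtain ⟨ζ, hζ, h⟩ := hφ
  exact ⟨fun x => ζ fun i => g i x, fun i => (hζ i).comp hg, fun x => h _⟩

theorem mul (hu : HasPolyMul u) {φ ψ : (σ → ℤ) → G} (hφ : IsPolyMap u φ) (hψ : IsPolyMap u ψ) :
    IsPolyMap u fun x => φ x * ψ x := by
  obtain ⟨ξ, hξ, hφ⟩ := hφ
  obtain ⟨η, hη, hψ⟩ := hψ
  have := comp hu (g := Sum.elim (fun i x => ξ x i) (fun i x => η x i))
    (fun i => by cases i <;> simp [hξ, hη])
  simpa [hφ, hψ] using this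

/-- A map into `G` with polynomial multiplicative differences in the variable `t` that is
polynomial for `t = 0` is polynomial. -/
theorem of_difference {H : ℕ → Subgroup G} (h : IsCentralChain u H) (hu : HasPolyMul u)
    [DecidableEq σ] (t : σ) {φ ψ : (σ → ℤ) → G} (hmem : ∀ x, φ x ∈ H 0)
    (h0 : IsPolyMap u fun x => φ (Function.update x t 0)) (hψ : IsPolyMap u ψ)
    (hstep : ∀ x, φ (Function.update x t (x t + 1)) = φ x * ψ x) : IsPolyMap u φ := by
  choose ζ hζ using fun x => h.exists_canonicalProd (hmem x)
  refine ⟨ζ, fun i => ?_, fun x => (hζ x).symm⟩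
  obtain ⟨ζ₀, hζ₀, h0⟩ := h0
  obtain ⟨η, hη, hψ⟩ := hψ
  obtain ⟨μ, hμ, hmul⟩ := hu
  have hzero : ∀ x, ζ (Function.update x t 0) = ζ₀ x := fun x =>
    h.canonicalProd_injective ((hζ _).trans (h0 x))
  induction i using WellFoundedLT.induction with
  | _ i ih =>
  -- Cutting off at `i` makes the correction depend only on parameters covered by `ih`.
  let m (x : σ → ℤ) : Fin n ⊕ Fin n → ℤ :=
    Sum.elim (fun j => if j < i then ζ x j else 0) (fun j => if j < i then η x j else 0)
  refine IsPolyFun.of_difference t (g := fun x => μ (m x) i + η x i) ?_ ?_ fun x => ?_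
  · simpa only [hzero] using hζ₀ i
  · refine IsPolyFun.add ((hμ i).comp (g := fun j x => m x j) fun j => ?_) (hη i)
    rcases j with j | j
    all_goals
      by_cases hj : j < i
      · simp only [m, Sum.elim_inl, Sum.elim_inr, hj, if_true]
        first | exact ih j hj | exact hη j
      · simp only [m, Sum.elim_inl, Sum.elim_inr, hj, if_false]
        exact .const 0
  · have := h.mul_param_eq i (ξ := ζ x) (η := η x)
      (ζ := ζ (Function.update x t (x t + 1))) (ζ' := μ (m x))
      (by rw [hζ, hζ, ← hψ, hstep]) (by simpa [m] using hmul (m x))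
    rw [this]
    ring

theorem zpow {H : ℕ → Subgroup G} (h : IsCentralChain u H) (hu : HasPolyMul u)
    {φ : (σ → ℤ) → G} {e : (σ → ℤ) → ℤ} (hφ : IsPolyMap u φ) (he : IsPolyFun e) :
    IsPolyMap u fun x => φ x ^ e x := by
  have key : IsPolyMap u fun x : Option (Fin n) → ℤ =>
      canonicalProd u (fun i => x (some i)) ^ x none := by
    refine of_difference h hu none (fun x => zpow_mem (h.canonicalProd_mem _) _) ?_
      (of_canonicalProd fun i => .proj (some i)) fun x => ?_
    · simpa using one
    · simp [zpow_add]
  obtain ⟨ξ, hξ, hφ⟩ := hφ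
  have := key.comp (g := fun o x => o.elim (e x) (ξ x))
    (fun o => by cases o <;> simp [hξ, he])
  simpa [hφ] using this

theorem canonicalProd {H : ℕ → Subgroup G} (h : IsCentralChain u H) (hu : HasPolyMul u) {m : ℕ}
    {v : Fin m → (σ → ℤ) → G} {e : Fin m → (σ → ℤ) → ℤ} (hv : ∀ j, IsPolyMap u (v j))
    (he : ∀ j, IsPolyFun (e j)) :
    IsPolyMap u fun x => _root_.canonicalProd (fun j => v j x) (fun j => e j x) := by
  induction m with
  | zero => simpa [_root_.canonicalProd] using one
  | succ m ih =>
    simp only [canonicalProd_succ]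
    exact mul hu (zpow h hu (hv 0) (he 0)) (ih (fun j => hv j.succ) (fun j => he j.succ))

/-- Raising `b t` by one multiplies the value on the right by the conjugate of `⁅x⁻¹, g⁻¹⁆` by the
same power of `g`. That commutator is one step deeper, so descending induction along the chain
applies. -/
theorem conj_zpow {H : ℕ → Subgroup G} (h : IsCentralChain u H) (hu : HasPolyMul u)
    [DecidableEq σ] (g : G) (t : σ) {x : G} (hx : x ∈ H 0) :
    IsPolyMap u fun b : σ → ℤ => (g ^ b t)⁻¹ * x * g ^ b t := by
  suffices ∀ k ≤ n, ∀ x ∈ H k, IsPolyMap u fun b : σ → ℤ => (g ^ b t)⁻¹ * x * g ^ b t from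
    this 0 (Nat.zero_le n) x hx
  intro k hk
  induction hk using Nat.decreasingInduction with
  | self =>
    intro x hx
    rw [h.bot, Subgroup.mem_bot] at hx
    simpa [hx] using one
  | of_succ k _ ih =>
    intro x hx
    have hx0 := h.antitone (Nat.zero_le k) hx
    have hc := h.comm k x⁻¹ (inv_mem hx) g⁻¹
    refine of_difference h hu t (fun b => ?_) ?_ (ih _ hc) fun b => ?_
    · simpa using (h.normal 0).conj_mem x hx0 (g ^ b t)⁻¹
    · obtain ⟨ξ, rfl⟩ := h.exists_canonicalProd hx0
      simpa using const ξ
    · simp only [Function.update_self, zpow_add, zpow_one, commutatorElement_def]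
      group

end IsPolyMap

/-! ### Polynomial multiplication and the main theorem. -/

theorem IsPolyMap.cons {n : ℕ} {σ : Type*} {u : Fin (n + 1) → G} {e : (σ → ℤ) → ℤ}
    {φ : (σ → ℤ) → G} (he : IsPolyFun e) (hφ : IsPolyMap (fun i => u i.succ) φ) :
    IsPolyMap u fun x => u 0 ^ e x * φ x := by
  obtain ⟨ζ, hζ, hφ⟩ := hφ
  refine ⟨fun x => Fin.cons (e x) (ζ x), fun i => ?_, fun x => ?_⟩
  · refine Fin.cases ?_ (fun i => ?_) i
    · simpa using he
    · simpa using hζ i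
  · simp [canonicalProd_succ, hφ]

theorem conj_canonicalProd {m : ℕ} (v : Fin m → G) (ξ : Fin m → ℤ) (g : G) :
    g⁻¹ * canonicalProd v ξ * g = canonicalProd (fun j => g⁻¹ * v j * g) ξ := by
  induction m with
  | zero => simp [canonicalProd]
  | succ m ih =>
    have hz := conj_zpow (i := ξ 0) (a := g⁻¹) (b := v 0)
    rw [inv_inv] at hz
    rw [canonicalProd_succ, canonicalProd_succ, ← ih, hz]
    group

theorem IsCentralChain.hasPolyMul {n : ℕ} {u : Fin n → G} {H : ℕ → Subgroup G}
    (h : IsCentralChain u H) : HasPolyMul u := by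
  induction n generalizing H with
  | zero => exact ⟨fun _ => Fin.elim0, fun i => i.elim0, fun x => by simp [canonicalProd]⟩
  | succ n ih =>
    have hu := ih h.tail
    have hconj : IsPolyMap (fun i => u i.succ) fun x : Fin (n + 1) ⊕ Fin (n + 1) → ℤ =>
        canonicalProd
          (fun j : Fin n => (u 0 ^ x (Sum.inr 0))⁻¹ * u j.succ * u 0 ^ x (Sum.inr 0))
          (fun j => x (Sum.inl j.succ)) :=
      IsPolyMap.canonicalProd h.tail hu
        (fun j => IsPolyMap.conj_zpow h.tail hu (u 0) (Sum.inr 0)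
          (h.tail.antitone (Nat.zero_le j) (h.tail.generator_mem j)))
        (fun j => .proj _)
    have htail : IsPolyMap (fun i => u i.succ) fun x : Fin (n + 1) ⊕ Fin (n + 1) → ℤ =>
        canonicalProd (fun i => u i.succ) (fun j => x (Sum.inr j.succ)) :=
      IsPolyMap.of_canonicalProd fun j => .proj _
    have key := IsPolyMap.cons ((IsPolyFun.proj (Sum.inl 0)).add (.proj (Sum.inr 0)))
      (IsPolyMap.mul hu hconj htail)
    unfold HasPolyMul
    convert key using 2 with x
    rw [canonicalProd_succ, canonicalProd_succ, ← conj_canonicalProd, zpow_add]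
    group

theorem IsCanonicalBasis.exists_isCentralChain {n : ℕ} {u : Fin n → G}
    (hu : IsCanonicalBasis u) : ∃ H, IsCentralChain u H := by
  obtain ⟨H, ⟨-, hc⟩, hbot, hgen, hinf⟩ := hu
  -- A canonical basis leaves `H` unrestricted by inclusion beyond `n`; truncation makes it trivial
  -- there.
  refine ⟨fun i => H (min i n), ⟨fun i => ?_, fun i x hx g => ?_, by simpa, fun i => ?_,
    fun i k hk => ?_⟩⟩
  · rcases lt_or_ge i n with hi | hi
    · have := hgen ⟨i, hi⟩
      simp only at this
      rw [min_eq_left hi.le, min_eq_left hi, this]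
      exact le_sup_left
    · rw [min_eq_right hi, min_eq_right (hi.trans (Nat.le_succ i))]
  · rcases lt_or_ge i n with hi | hi
    · rw [min_eq_left hi.le] at hx
      rw [min_eq_left hi]
      exact hc x i hx g
    · rw [min_eq_right hi, hbot, Subgroup.mem_bot] at hx
      simp [hx, one_mem]
  · simpa only [min_eq_left i.2.le, min_eq_left (Nat.succ_le_of_lt i.2)] using hgen i
  · exact hinf i k (by simpa only [min_eq_left (Nat.succ_le_of_lt i.2)] using hk)

end

theorem theorem6p5 {G : Type*} [Group G] [Group.FG G] [Group.IsNilpotent G]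
    (htf : ∀ g : G, IsOfFinOrder g → g = 1)
    {n : ℕ} (u : Fin n → G) (hu : IsCanonicalBasis u) :
    (∀ i : Fin n, ∃ f : MvPolynomial (Fin n ⊕ Fin n) ℚ, ∀ x y : G,
      (hu.param (x * y) i : ℚ) =
        MvPolynomial.eval
          (Sum.elim (fun j => (hu.param x j : ℚ)) (fun j => (hu.param y j : ℚ))) f) ∧
    (∀ i : Fin n, ∃ f : MvPolynomial (Option (Fin n)) ℚ, ∀ (x : G) (k : ℤ),
      (hu.param (x ^ k) i : ℚ) =
        MvPolynomial.eval
          (fun o => o.elim (k : ℚ) (fun j => (hu.param x j : ℚ))) f) := by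
  obtain ⟨H, h⟩ := hu.exists_isCentralChain
  have hmul := h.hasPolyMul
  constructor
  · intro i
    obtain ⟨ζ, hζ, hprod⟩ := hmul
    obtain ⟨f, hf⟩ := hζ i
    refine ⟨f, fun x y => ?_⟩
    have h1 := hprod (Sum.elim (hu.param x) (hu.param y))
    simp only [Sum.elim_inl, Sum.elim_inr, hu.canonicalProd_param] at h1
    have h2 : hu.param (x * y) = ζ (Sum.elim (hu.param x) (hu.param y)) :=
      h.canonicalProd_injective (by rw [hu.canonicalProd_param, h1])
    rw [h2, hf]
    congr 2
    funext j
    cases j <;> rfl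
  · intro i
    have hpow : IsPolyMap u fun x : Option (Fin n) → ℤ =>
        canonicalProd u (fun i => x (some i)) ^ x none :=
      IsPolyMap.zpow h hmul (.of_canonicalProd fun i => .proj (some i)) (.proj none)
    obtain ⟨ζ, hζ, hprod⟩ := hpow
    obtain ⟨f, hf⟩ := hζ i
    refine ⟨f, fun x k => ?_⟩
    have h1 := hprod (fun o => o.elim k (hu.param x))
    simp only [Option.elim_some, Option.elim_none, hu.canonicalProd_param] at h1
    have h2 : hu.param (x ^ k) = ζ (fun o => o.elim k (hu.param x)) :=
      h.canonicalProd_injective (by rw [hu.canonicalProd_param, h1])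
    rw [h2, hf]
    congr 2
    funext o
    cases o <;> rfl
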